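/- Theorem 1.4. Let $r,q:\mathbb R\to\mathbb R$ be such that $r>0$ and $q\ge 0$ almost everywhere, $\frac1r\in L_1^{\mathrm{loc}}(\mathbb R)$ and $q\in L_1^{\mathrm{loc}}(\mathbb R)$, and suppose that $$\int_{-\infty}^x q(t)\,dt>0,\qquad \int_x^\infty q(t)\,dt>0\qquad\text{for all }x\in\mathbb R$$ (the integrals may be infinite). Let $p\in[1,\infty)$, and let $L_p=L_p(\mathbb R)$ be the space of real-valued, or of complex-valued, functions. Consider the equation $$-(r(x)y'(x))'+q(x)y(x)=f(x),\qquad x\in\mathbb R .\tag{1}$$ A solution of (1) is a function $y$ that is locally absolutely continuous on $\mathbb R$ together with $ry'$ (that is, $ry'$ agrees almost everywhere with a locally absolutely continuous function, with which it is identified) and that satisfies (1) almost everywhere. Equation (1) is called correctly solvable in $L_p$ if for every $f\in L_p$ there is a unique solution $y\in L_p$ of (1), and there is a constant $c\in(0,\infty)$ such that $\|y\|_p\le c\|f\|_p$ for every $f\in L_p$ and its solution $y\in L_p$. There exists a fundamental system of real solutions $\{u,v\}$ of $(rz')'=qz$ such that $u>0$, $v>0$, $ru'\le 0$, $rv'\ge0$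 and $rv'\,u-ru'\,v=1$ on $\mathbb R$, $$\lim_{x\to-\infty}\frac{v(x)}{u(x)}=\lim_{x\to+\infty}\frac{u(x)}{v(x)}=0,$$ $$\int_{-\infty}^0\frac{dt}{r v^2}=\int_0^\infty\frac{dt}{r u^2}=\infty,\qquad \int_0^\infty\frac{dt}{r v^2}<\infty,\qquad \int_{-\infty}^0\frac{dt}{r u^2}<\infty .$$ For every such system put $$G(x,t)=\begin{cases}u(x)v(t),& x\ge t,\\ u(t)v(x),& x\le t,\end{cases}\qquad (Gf)(x)=\int_{-\infty}^\infty G(x,t)f(t)\,dt,\quad x\in\mathbb R .$$ Then equation (1) is correctly solvable in $L_p$ if and only if $G$ is a bounded operator from $L_p$ to $L_p$, that is, for every $f\in L_p$ the integral $(Gf)(x)$ converges absolutely for all $x\in\mathbb R$, $Gf\in L_p$, and $\|Gf\|_p\le C\|f\|_p$ with a constant $C$ independent of $f\in L_p$. -/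

import Mathlib

open MeasureTheory Filter Set Topology
open scoped ENNReal NNReal

namespace SturmLiouville

/-- Local absolute continuity on `ℝ`: absolute continuity on every compact interval. -/
def LocallyAC {E : Type*} [PseudoMetricSpace E] (y : ℝ → E) : Prop :=
  ∀ a b : ℝ, AbsolutelyContinuousOnInterval y a b

/-- `y` is a solution of `-(r y')' + q y = f` and `w` is the (locally absolutely continuous
representative of the) function `r y'`. As `r` and `y'` are only defined almost everywhere, the
identity `w = r y'` and the equation are required almost everywhere. -/
structure IsSolutionWith {𝕜 : Type*} [RCLike 𝕜] (r q : ℝ → ℝ) (f y w : ℝ → 𝕜) : Prop where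
  ac : LocallyAC y
  ac_quasi : LocallyAC w
  quasi_eq : ∀ᵐ x : ℝ, DifferentiableAt ℝ y x ∧ w x = r x • deriv y x
  eqn : ∀ᵐ x : ℝ, DifferentiableAt ℝ w x ∧ -deriv w x + q x • y x = f x

/-- `y` is a solution of `-(r y')' + q y = f`: it is locally absolutely continuous together with
`r y'` and satisfies the equation almost everywhere. -/
def IsSolution {𝕜 : Type*} [RCLike 𝕜] (r q : ℝ → ℝ) (f y : ℝ → 𝕜) : Prop :=
  ∃ w : ℝ → 𝕜, IsSolutionWith r q f y w

/-- Correct solvability of `-(r y')' + q y = f` in `L_p(ℝ)`: every `f ∈ L_p` has a unique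
solution `y ∈ L_p`, and `‖y‖_p ≤ c ‖f‖_p` with `c` independent of `f`.
(A solution is continuous, so uniqueness as a function and uniqueness in `L_p` agree.) -/
def CorrectlySolvable (𝕜 : Type*) [RCLike 𝕜] (r q : ℝ → ℝ) (p : ℝ≥0∞) : Prop :=
  (∀ f : ℝ → 𝕜, MemLp f p volume → ∃! y : ℝ → 𝕜, IsSolution r q f y ∧ MemLp y p volume) ∧
  ∃ c : ℝ≥0, 0 < c ∧ ∀ f y : ℝ → 𝕜, MemLp f p volume → IsSolution r q f y →
    MemLp y p volume → eLpNorm y p volume ≤ c * eLpNorm f p volume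

/-- The properties of the distinguished fundamental system of solutions `{u, v}` of
`(r z')' = q z`; `u₁` and `v₁` stand for `r u'` and `r v'`. Since `r > 0`, the signs of `u'`, `v'`
are those of `u₁`, `v₁`, and the Wronskian identity `r (v' u - u' v) = 1` (which contains linear
independence) reads `v₁ u - u₁ v = 1`. -/
structure IsPrincipalSystemWith (r q u v u₁ v₁ : ℝ → ℝ) : Prop where
  sol_u : IsSolutionWith r q 0 u u₁
  sol_v : IsSolutionWith r q 0 v v₁
  pos_u : ∀ x, 0 < u x
  pos_v : ∀ x, 0 < v x
  deriv_u : ∀ x, u₁ x ≤ 0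
  deriv_v : ∀ x, 0 ≤ v₁ x
  wronskian : ∀ x, v₁ x * u x - u₁ x * v x = 1
  tendsto_bot : Tendsto (fun x => v x / u x) atBot (𝓝 0)
  tendsto_top : Tendsto (fun x => u x / v x) atTop (𝓝 0)
  int_v_left : ∫⁻ t in Iic (0 : ℝ), ENNReal.ofReal (1 / (r t * v t ^ 2)) = ∞
  int_u_right : ∫⁻ t in Ici (0 : ℝ), ENNReal.ofReal (1 / (r t * u t ^ 2)) = ∞
  int_v_right : ∫⁻ t in Ici (0 : ℝ), ENNReal.ofReal (1 / (r t * v t ^ 2)) < ∞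
  int_u_left : ∫⁻ t in Iic (0 : ℝ), ENNReal.ofReal (1 / (r t * u t ^ 2)) < ∞

/-- `{u, v}` is the distinguished fundamental system of solutions of `(r z')' = q z`. -/
def IsPrincipalSystem (r q u v : ℝ → ℝ) : Prop :=
  ∃ u₁ v₁ : ℝ → ℝ, IsPrincipalSystemWith r q u v u₁ v₁

/-- The Green function: `u x * v t` for `t ≤ x`, and `u t * v x` for `x ≤ t`. -/
noncomputable def greenKernel (u v : ℝ → ℝ) (x t : ℝ) : ℝ :=
  if t ≤ x then u x * v t else u t * v x

/-- The Green integral operator. -/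
noncomputable def greenOp {𝕜 : Type*} [RCLike 𝕜] (u v : ℝ → ℝ) (f : ℝ → 𝕜) (x : ℝ) : 𝕜 :=
  ∫ t, greenKernel u v x t • f t

/-- The Green integral operator is a (well-defined) bounded operator `L_p(ℝ) → L_p(ℝ)`. -/
def GreenBounded (𝕜 : Type*) [RCLike 𝕜] (u v : ℝ → ℝ) (p : ℝ≥0∞) : Prop :=
  (∀ f : ℝ → 𝕜, MemLp f p volume →
    (∀ x, Integrable (fun t => greenKernel u v x t • f t) volume) ∧
      MemLp (greenOp u v f) p volume) ∧
  ∃ C : ℝ≥0, ∀ f : ℝ → 𝕜, MemLp f p volume →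
    eLpNorm (greenOp u v f) p volume ≤ C * eLpNorm f p volume

end SturmLiouville

/-!
Writing `α = 1 / r` and `w = r y'`, the equation is the linear system `y' = α w`, `w' = q y - f`
with locally integrable coefficients, whose homogeneous version is solved globally by a contraction
in a weighted sup norm (`exists_hasACDeriv_clm`).

*Existence of the distinguished system.* Let `c`, `s` be the homogeneous solutions with initial
values `(1, 0)` and `(0, 1)`. Since `(y · r y')' = (r y')² / r + q y² ≥ 0` for every solution, `c`
is at least `1`, and `s / c` is increasing because `(s / c)' = 1 / (r c²)`. The same energy
inequality, applied to the solution that vanishes at a point `T`, gives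
`(s / c)(T) · r c' ≤ r s'` before `T`. As `q` has mass on both half-lines, `r c'` is not
identically zero there, so `s / c` has finite limits `L` at `+∞` and `-M` at `-∞`
(`exists_limit_quotient`). Then `u = L c - s` and `v = (s + M c) / (L + M)` are the required
solutions; the integral conditions follow from `(v / u)' = 1 / (r u²)` and
`(u / v)' = -1 / (r v²)`.

*Equivalence.* If the Green integrals converge, `Gf` is a solution by variation of constants. Every
homogeneous solution is `a u + b v`, and it is in `L_p` only if `a = b = 0`, as `v` dominates near
`+∞` and `u` near `-∞`; so boundedness of `G` gives correct solvability. Conversely, for compactly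
supported data `Gf` is a multiple of `u` near `+∞` and of `v` near `-∞`, so the same domination
forces the `L_p`-solution to be `Gf` (`IsPrincipalSystemWith.eq_greenOp_of_support`). Applied to
truncations of `|f|`, monotone convergence bounds the Green integral of `|f|` in `L_p`. Hence it is
finite at one point, and therefore at every point, and it majorizes `|Gf|`.
-/

namespace SturmLiouville

/-! ### Locally absolutely continuous functions and their derivatives -/

section Calculus

theorem ae_comp_neg {P : ℝ → Prop} (h : ∀ᵐ x, P x) : ∀ᵐ x : ℝ, P (-x) :=
  (Measure.measurePreserving_neg volume).quasiMeasurePreserving.ae h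

theorem lintegral_Iic_eq_lintegral_Ici_neg (f : ℝ → ℝ≥0∞) (a : ℝ) :
    ∫⁻ t in Iic a, f t = ∫⁻ t in Ici (-a), f (-t) := by
  have := (Measure.measurePreserving_neg (volume : Measure ℝ)).setLIntegral_comp_preimage_emb
    (MeasurableEquiv.neg ℝ).measurableEmbedding f (Iic a)
  rw [← this]
  simp

variable {E : Type*} [NormedAddCommGroup E] [NormedSpace ℝ E]

/-- Domination of increments on each compact interval transfers absolute continuity; compositions
with Lipschitz maps, coordinate projections and vector-valued integrals are all covered. -/
theorem LocallyAC.of_dist_le {X Y : Type*} [PseudoMetricSpace X] [PseudoMetricSpace Y]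
    {F : ℝ → X} {G : ℝ → Y} (hG : LocallyAC G)
    (h : ∀ a b : ℝ, ∃ K : ℝ, ∀ x ∈ uIcc a b, ∀ y ∈ uIcc a b,
      dist (F x) (F y) ≤ K * dist (G x) (G y)) : LocallyAC F := by
  intro a b
  obtain ⟨K, hK⟩ := h a b
  have hG' := hG a b
  unfold AbsolutelyContinuousOnInterval at hG' ⊢
  refine squeeze_zero' (.of_forall fun _ => Finset.sum_nonneg fun _ _ => dist_nonneg) ?_
    (by simpa using hG'.const_mul K)
  filter_upwards [mem_inf_of_right (mem_principal_self _)] with I hI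
  rw [Finset.mul_sum]
  exact Finset.sum_le_sum fun i hi => hK _ (hI.1 i hi).1 _ (hI.1 i hi).2

theorem LocallyAC.continuous {X : Type*} [SeminormedAddCommGroup X] {F : ℝ → X}
    (hF : LocallyAC F) : Continuous F := by
  rw [continuous_iff_continuousAt]
  intro x
  refine ((hF (x - 1) (x + 1)).continuousOn).continuousAt ?_
  rw [uIcc_of_le (by linarith)]
  exact Icc_mem_nhds (by linarith) (by linarith)

/-- `F` is locally absolutely continuous with derivative `F'` almost everywhere, that is, `F` is
a primitive of `F'` in the sense of Lebesgue. The derivative is an arbitrary function with the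
right values almost everywhere, so that it can be given by a formula. -/
def HasACDeriv (F F' : ℝ → E) : Prop :=
  LocallyAC F ∧ ∀ᵐ x, HasDerivAt F (F' x) x

namespace HasACDeriv

variable {F F' G G' : ℝ → E}

theorem continuous (h : HasACDeriv F F') : Continuous F := h.1.continuous

theorem congr (h : HasACDeriv F F') (hG : F' =ᵐ[volume] G') : HasACDeriv F G' :=
  ⟨h.1, by filter_upwards [h.2, hG] with x h1 h2; rwa [← h2]⟩

theorem const (c : E) : HasACDeriv (fun _ => c) (fun _ => 0) :=
  ⟨fun _ _ => LipschitzOnWith.absolutelyContinuousOnInterval (K := 0)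
    (LipschitzWith.const c).lipschitzOnWith, .of_forall fun x => hasDerivAt_const x c⟩

theorem add (hF : HasACDeriv F F') (hG : HasACDeriv G G') :
    HasACDeriv (fun x => F x + G x) (fun x => F' x + G' x) :=
  ⟨fun a b => (hF.1 a b).fun_add (hG.1 a b), by
    filter_upwards [hF.2, hG.2] with x h1 h2 using h1.add h2⟩

theorem sub (hF : HasACDeriv F F') (hG : HasACDeriv G G') :
    HasACDeriv (fun x => F x - G x) (fun x => F' x - G' x) :=
  ⟨fun a b => (hF.1 a b).fun_sub (hG.1 a b), by
    filter_upwards [hF.2, hG.2] with x h1 h2 using h1.sub h2⟩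

theorem neg (hF : HasACDeriv F F') : HasACDeriv (fun x => -F x) (fun x => -F' x) :=
  ⟨fun a b => (hF.1 a b).fun_neg, by filter_upwards [hF.2] with x h1 using h1.neg⟩

theorem smul {A : Type*} [NormedRing A] [NormedAlgebra ℝ A] [Module A E] [NormSMulClass A E]
    [IsBoundedSMul A E] [IsScalarTower ℝ A E] {a a' : ℝ → A}
    (ha : HasACDeriv a a') (hF : HasACDeriv F F') :
    HasACDeriv (fun x => a x • F x) (fun x => a x • F' x + a' x • F x) :=
  ⟨fun x y => (ha.1 x y).fun_smul (hF.1 x y), by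
    filter_upwards [ha.2, hF.2] with x h1 h2 using h1.smul h2⟩

theorem mul {F F' G G' : ℝ → ℝ} (hF : HasACDeriv F F') (hG : HasACDeriv G G') :
    HasACDeriv (fun x => F x * G x) (fun x => F' x * G x + F x * G' x) :=
  (hF.smul hG).congr (.of_forall fun x => by simp [add_comm])

theorem const_mul {F F' : ℝ → ℝ} (c : ℝ) (hF : HasACDeriv F F') :
    HasACDeriv (fun x => c * F x) (fun x => c * F' x) :=
  ((const c).mul hF).congr (.of_forall fun x => by simp)

/-- Chain rule for an outer function that is continuously differentiable on the range. -/
theorem comp {g g' F F' : ℝ → ℝ} (hF : HasACDeriv F F')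
    (hg : ∀ x, ContDiffAt ℝ 1 g (F x)) (hg' : ∀ x, HasDerivAt g (g' (F x)) (F x)) :
    HasACDeriv (fun x => g (F x)) (fun x => g' (F x) * F' x) := by
  refine ⟨hF.1.of_dist_le fun a b => ?_, ?_⟩
  · have hc : IsCompact (F '' uIcc a b) := isCompact_uIcc.image hF.continuous
    have hp : IsPreconnected (F '' uIcc a b) :=
      isPreconnected_uIcc.image _ hF.continuous.continuousOn
    have hd : ContDiffOn ℝ 1 g (F '' uIcc a b) := by
      rintro _ ⟨x, -, rfl⟩
      exact (hg x).contDiffWithinAt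
    obtain ⟨K, hK⟩ := hd.exists_lipschitzOnWith (by decide) hp.ordConnected.convex hc
    exact ⟨K, fun x hx y hy => hK.dist_le_mul _ (mem_image_of_mem _ hx) _ (mem_image_of_mem _ hy)⟩
  · filter_upwards [hF.2] with x hx using (hg' x).comp x hx

theorem div {F F' G G' : ℝ → ℝ} (hF : HasACDeriv F F') (hG : HasACDeriv G G')
    (h0 : ∀ x, G x ≠ 0) :
    HasACDeriv (fun x => F x / G x) (fun x => (F' x * G x - F x * G' x) / G x ^ 2) := by
  have := hF.mul (hG.comp (g := fun t => t⁻¹) (g' := fun t => -(t ^ 2)⁻¹)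
    (fun x => contDiffAt_inv ℝ (h0 x)) (fun x => hasDerivAt_inv (h0 x)))
  refine (this.congr (.of_forall fun x => ?_))
  have := h0 x
  field_simp
  ring

theorem eq_of_zero (h : HasACDeriv F (fun _ => 0)) (x y : ℝ) : F x = F y := by
  obtain ⟨C, hC⟩ := (h.1 x y).const_of_ae_hasDerivAt_zero (by
    filter_upwards [h.2] with t ht _ using ht)
  rw [hC x left_mem_uIcc, hC y right_mem_uIcc]

theorem of_locallyIntegrable [CompleteSpace E] {f : ℝ → E} (hf : LocallyIntegrable f)
    (a : ℝ) (e : E) : HasACDeriv (fun x => e + ∫ t in a..x, f t) f := by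
  have hi : ∀ x y, IntervalIntegrable f volume x y := fun x y =>
    intervalIntegrable_iff.2 ((hf.integrableOn_isCompact isCompact_uIcc).mono_set uIoc_subset_uIcc)
  have hn : ∀ x y, IntervalIntegrable (fun t => ‖f t‖) volume x y := fun x y => (hi x y).norm
  refine ⟨?_, ?_⟩
  · have h1 : LocallyAC (fun x => ∫ t in a..x, ‖f t‖) := by
      intro b c
      refine ((hn (min a (min b c)) (max a (max b c))
        ).absolutelyContinuousOnInterval_intervalIntegral (c := a) ?_).mono ?_
      · rw [uIcc_of_le (by simp)]; simp
      · rw [uIcc_of_le (by simp : min a (min b c) ≤ max a (max b c)), uIcc]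
        exact Icc_subset_Icc (by simp) (by simp)
    refine h1.of_dist_le fun b c => ⟨1, fun x _ y _ => ?_⟩
    rw [dist_comm, dist_comm (∫ t in a..x, ‖f t‖), dist_add_left, dist_eq_norm, dist_eq_norm,
      intervalIntegral.integral_interval_sub_left (hi _ _) (hi _ _),
      intervalIntegral.integral_interval_sub_left (hn _ _) (hn _ _), one_mul]
    exact intervalIntegral.norm_integral_le_abs_integral_norm
  · filter_upwards [_root_.LocallyIntegrable.ae_hasDerivAt_integral hf] with x hx
    exact (hx a).const_add e

variable {F F' : ℝ → ℝ}

theorem deriv_ae (h : HasACDeriv F F') : deriv F =ᵐ[volume] F' := by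
  filter_upwards [h.2] with x hx using hx.deriv

theorem intervalIntegrable (h : HasACDeriv F F') (a b : ℝ) : IntervalIntegrable F' volume a b :=
  (h.1 a b).intervalIntegrable_deriv.congr_ae (ae_restrict_of_ae h.deriv_ae)

theorem integral_eq (h : HasACDeriv F F') (a b : ℝ) : ∫ t in a..b, F' t = F b - F a := by
  rw [← (h.1 a b).integral_deriv_eq_sub]
  exact intervalIntegral.integral_congr_ae (by
    filter_upwards [h.deriv_ae] with x hx _ using hx.symm)

/-- Reflection, through the representation of `F` as an integral of its derivative. -/
theorem comp_neg (h : HasACDeriv F F') : HasACDeriv (fun x => F (-x)) (fun x => -F' (-x)) := by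
  have hl : LocallyIntegrable (fun x => -F' (-x)) := by
    intro x
    refine ⟨Ioc (x - 1) (x + 1), Ioc_mem_nhds (by linarith) (by linarith), ?_⟩
    refine (intervalIntegrable_iff_integrableOn_Ioc_of_le (by linarith)).1 ?_
    have := ((h.intervalIntegrable (-(x - 1)) (-(x + 1))).comp_sub_left 0).neg
    simpa using! this
  have := of_locallyIntegrable hl 0 (F 0)
  convert this using 2 with x
  rw [intervalIntegral.integral_neg, intervalIntegral.integral_comp_neg (fun t => F' t),
    h.integral_eq]
  simp

theorem monotone (h : HasACDeriv F F') (h0 : ∀ᵐ x, 0 ≤ F' x) : Monotone F := by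
  intro a b hab
  have := intervalIntegral.integral_nonneg_of_ae_restrict hab (ae_restrict_of_ae h0)
  rw [h.integral_eq] at this
  linarith

/-- If `F a = F b` then `F` is constant on `[a, b]`, and its derivative vanishes at almost every
point between `a` and `b`. -/
theorem strictMono (h : HasACDeriv F F') (h0 : ∀ᵐ x, 0 < F' x) : StrictMono F := by
  have hm := h.monotone (h0.mono fun x hx => hx.le)
  intro a b hab
  refine (hm hab.le).lt_of_ne fun hEq => ?_
  have hne : ∃ᵐ x ∂(volume.restrict (Ioo a b)), True := by
    rw [frequently_true_iff_neBot, ae_neBot, Ne, Measure.restrict_eq_zero]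
    simp [hab]
  obtain ⟨x, -, hx, hd, hp⟩ := (hne.and_eventually
    ((ae_restrict_mem measurableSet_Ioo).and (ae_restrict_of_ae (h.2.and h0)))).exists
  have : F =ᶠ[𝓝 x] fun _ => F a := by
    filter_upwards [Ioo_mem_nhds hx.1 hx.2] with y hy
    exact le_antisymm (hEq ▸ hm hy.2.le) (hm hy.1.le)
  have := (hd.congr_of_eventuallyEq this.symm).unique (hasDerivAt_const x (F a))
  linarith

theorem lintegral_Ioc (h : HasACDeriv F F') (h0 : ∀ᵐ x, 0 ≤ F' x) {a b : ℝ} (hab : a ≤ b) :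
    ∫⁻ t in Ioc a b, ENNReal.ofReal (F' t) = ENNReal.ofReal (F b - F a) := by
  rw [← h.integral_eq, intervalIntegral.integral_of_le hab,
    ofReal_integral_eq_lintegral_ofReal ((h.intervalIntegrable a b).1) (ae_restrict_of_ae h0)]

/-- A bounded primitive has a derivative integrable up to `+∞`. -/
theorem lintegral_Ici_lt_top (h : HasACDeriv F F') (h0 : ∀ᵐ x, 0 ≤ F' x) {a C : ℝ}
    (hC : ∀ x, F x ≤ C) : ∫⁻ t in Ici a, ENNReal.ofReal (F' t) < ∞ := by
  have hU : Ioi a = ⋃ n : ℕ, Ioc a (a + n) := by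
    ext x
    simp only [mem_Ioi, mem_iUnion, mem_Ioc]
    refine ⟨fun hx => ?_, fun ⟨n, hn⟩ => hn.1⟩
    obtain ⟨n, hn⟩ := exists_nat_ge (x - a)
    exact ⟨n, hx, by linarith⟩
  rw [setLIntegral_congr Ioi_ae_eq_Ici.symm, hU, setLIntegral_iUnion_of_directed]
  · refine lt_of_le_of_lt (iSup_le fun n => ?_) (ENNReal.ofReal_lt_top (r := C - F a))
    rw [h.lintegral_Ioc h0 (by simp)]
    exact ENNReal.ofReal_le_ofReal (by linarith [hC (a + n)])
  · exact Monotone.directed_le fun m n hmn =>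
      Ioc_subset_Ioc_right (by simpa using hmn)

theorem lintegral_Ici_eq_top (h : HasACDeriv F F') (h0 : ∀ᵐ x, 0 ≤ F' x) (a : ℝ)
    (hF : Tendsto F atTop atTop) : ∫⁻ t in Ici a, ENNReal.ofReal (F' t) = ∞ := by
  have h1 : Tendsto (fun x => ENNReal.ofReal (F x - F a)) atTop (𝓝 ∞) :=
    ENNReal.tendsto_ofReal_atTop.comp (tendsto_atTop_add_const_right _ _ hF)
  refine top_le_iff.1 (le_of_tendsto h1 ?_)
  filter_upwards [eventually_ge_atTop a] with x hx
  rw [← h.lintegral_Ioc h0 hx]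
  exact lintegral_mono_set fun t ht => ht.1.le

theorem lintegral_Iic_lt_top (h : HasACDeriv F F') (h0 : ∀ᵐ x, 0 ≤ F' x) {a C : ℝ}
    (hC : ∀ x, C ≤ F x) : ∫⁻ t in Iic a, ENNReal.ofReal (F' t) < ∞ := by
  rw [lintegral_Iic_eq_lintegral_Ici_neg]
  refine (h.comp_neg.neg.congr (.of_forall fun x => neg_neg _)).lintegral_Ici_lt_top
    (ae_comp_neg h0) (C := -C) fun x => ?_
  linarith [hC (-x)]

theorem lintegral_Iic_eq_top (h : HasACDeriv F F') (h0 : ∀ᵐ x, 0 ≤ F' x) (a : ℝ)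
    (hF : Tendsto F atBot atBot) : ∫⁻ t in Iic a, ENNReal.ofReal (F' t) = ∞ := by
  rw [lintegral_Iic_eq_lintegral_Ici_neg]
  exact (h.comp_neg.neg.congr (.of_forall fun x => neg_neg _)).lintegral_Ici_eq_top
    (ae_comp_neg h0) _
    (tendsto_neg_atBot_atTop.comp (hF.comp tendsto_neg_atTop_atBot))

end HasACDeriv

end Calculus

/-! ### Linear systems with locally integrable coefficients -/

section LinearODE

variable {E : Type*} [NormedAddCommGroup E] [NormedSpace ℝ E]

theorem locallyIntegrable_clm_apply {a : ℝ → E →L[ℝ] E} (ha : LocallyIntegrable a)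
    {Y : ℝ → E} (hY : Continuous Y) : LocallyIntegrable (fun t => a t (Y t)) := by
  rw [locallyIntegrable_iff]
  intro k hk
  obtain ⟨C, hC⟩ := hk.exists_bound_of_continuousOn hY.continuousOn
  have hak := ha.integrableOn_isCompact hk
  refine (hak.norm.mul_const C).mono'
    (ContinuousLinearMap.aestronglyMeasurable_comp₂ (ContinuousLinearMap.id ℝ (E →L[ℝ] E))
      hak.aestronglyMeasurable hY.aestronglyMeasurable) ?_
  filter_upwards [ae_restrict_mem hk.measurableSet] with t ht
  exact (a t).le_opNorm_of_le (hC t ht)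

/-- The weight `exp (2 |∫₀ˣ m|)` dominates twice its own integral against `m`; this makes the
Picard operator a contraction on all of `ℝ` at once. -/
theorem abs_integral_mul_exp_le {m : ℝ → ℝ} (hm : LocallyIntegrable m) (h0 : ∀ t, 0 ≤ m t)
    (x : ℝ) : |∫ t in (0 : ℝ)..x, m t * Real.exp (2 * |∫ s in (0 : ℝ)..t, m s|)| ≤
      Real.exp (2 * |∫ s in (0 : ℝ)..x, m s|) / 2 := by
  set S : ℝ → ℝ := fun x => ∫ s in (0 : ℝ)..x, m s with hS
  have hSd : HasACDeriv S m :=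
    by simpa using! HasACDeriv.of_locallyIntegrable hm 0 0
  have hS0 : S 0 = 0 := by simp [hS]
  have hmono := hSd.monotone (.of_forall h0)
  have hexp : ∀ k : ℝ, HasACDeriv (fun x => Real.exp (k * S x))
      (fun x => Real.exp (k * S x) * (k * m x)) := fun k =>
    (hSd.const_mul k).comp (fun x => Real.contDiff_exp.contDiffAt) (fun x => Real.hasDerivAt_exp _)
  have key : ∀ k : ℝ, ∫ t in (0 : ℝ)..x, m t * Real.exp (k * S t) * k = Real.exp (k * S x) - 1 := by
    intro k
    have := (hexp k).integral_eq 0 x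
    rw [hS0] at this
    simp only [mul_zero, Real.exp_zero] at this
    rw [← this]
    exact intervalIntegral.integral_congr fun t _ => by ring
  change |∫ t in (0 : ℝ)..x, m t * Real.exp (2 * |S t|)| ≤ Real.exp (2 * |S x|) / 2
  rcases le_total 0 x with hx | hx
  · have h1 : ∫ t in (0 : ℝ)..x, m t * Real.exp (2 * |S t|) =
        ∫ t in (0 : ℝ)..x, m t * Real.exp (2 * S t) := by
      refine intervalIntegral.integral_congr fun t ht => ?_
      rw [uIcc_of_le hx] at ht
      have : 0 ≤ S t := hS0 ▸ hmono ht.1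
      simp only [abs_of_nonneg this]
    have h2 := key 2
    rw [intervalIntegral.integral_mul_const] at h2
    have h3 : 0 ≤ S x := hS0 ▸ hmono hx
    have h4 := Real.one_le_exp (x := 2 * S x) (by positivity)
    rw [h1, abs_of_nonneg h3, abs_le]
    constructor <;> linarith
  · have h1 : ∫ t in (0 : ℝ)..x, m t * Real.exp (2 * |S t|) =
        ∫ t in (0 : ℝ)..x, m t * Real.exp (-2 * S t) := by
      refine intervalIntegral.integral_congr fun t ht => ?_
      rw [uIcc_of_ge hx] at ht
      have : S t ≤ 0 := hS0 ▸ hmono ht.2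
      simp only [abs_of_nonpos this, mul_neg, neg_mul]
    have h2 := key (-2)
    rw [intervalIntegral.integral_mul_const] at h2
    have h3 : S x ≤ 0 := hS0 ▸ hmono hx
    have h4 := Real.one_le_exp (x := -2 * S x) (by linarith)
    rw [h1, abs_of_nonpos h3, abs_le, show 2 * -S x = -2 * S x by ring]
    constructor <;> linarith

/-- Global solvability of the initial value problem for a linear system with locally integrable
coefficients (in the sense of Carathéodory). -/
theorem exists_hasACDeriv_clm [CompleteSpace E] {a : ℝ → E →L[ℝ] E} (ha : LocallyIntegrable a)
    (e : E) : ∃ Y : ℝ → E, Y 0 = e ∧ HasACDeriv Y (fun t => a t (Y t)) := by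
  have han : LocallyIntegrable (fun t => ‖a t‖) :=
    locallyIntegrable_iff.2 fun k hk => (ha.integrableOn_isCompact hk).norm
  set W : ℝ → ℝ := fun x => Real.exp (2 * |∫ s in (0 : ℝ)..x, ‖a s‖|) with hW
  have hW0 : ∀ x, 0 < W x := fun x => Real.exp_pos _
  have hW1 : ∀ x, 1 ≤ W x := fun x => Real.one_le_exp (by positivity)
  have hWc : Continuous W := by
    have := (HasACDeriv.of_locallyIntegrable han 0 0).continuous
    simp only [zero_add] at this
    fun_prop
  have hint : ∀ Z : BoundedContinuousFunction ℝ E,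
      LocallyIntegrable (fun t => a t (W t • Z t)) := fun Z =>
    locallyIntegrable_clm_apply ha (hWc.smul Z.continuous)
  have hbound : ∀ (Z : BoundedContinuousFunction ℝ E) (x : ℝ),
      ‖∫ t in (0 : ℝ)..x, a t (W t • Z t)‖ ≤ W x / 2 * ‖Z‖ := by
    intro Z x
    have h1 : IntervalIntegrable (fun t => ‖a t‖ * W t * ‖Z‖) volume 0 x := by
      refine IntervalIntegrable.mul_const (IntervalIntegrable.mul_continuousOn ?_ hWc.continuousOn) _
      exact intervalIntegrable_iff.2
        ((han.integrableOn_isCompact isCompact_uIcc).mono_set uIoc_subset_uIcc)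
    refine (intervalIntegral.norm_integral_le_abs_of_norm_le (.of_forall fun t => ?_) h1).trans ?_
    · refine ((a t).le_opNorm _).trans ?_
      rw [norm_smul, Real.norm_of_nonneg (hW0 t).le, mul_assoc]
      gcongr
      exact Z.norm_coe_le_norm t
    · rw [intervalIntegral.integral_mul_const, abs_mul, abs_norm]
      gcongr
      exact abs_integral_mul_exp_le han (fun t => norm_nonneg _) x
  let T : BoundedContinuousFunction ℝ E → BoundedContinuousFunction ℝ E := fun Z =>
    BoundedContinuousFunction.ofNormedAddCommGroup
      (fun x => (W x)⁻¹ • (e + ∫ t in (0 : ℝ)..x, a t (W t • Z t)))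
      ((hWc.inv₀ fun x => (hW0 x).ne').smul
        (HasACDeriv.of_locallyIntegrable (hint Z) 0 e).continuous)
      (‖e‖ + ‖Z‖ / 2) (by
        intro x
        rw [norm_smul, norm_inv, Real.norm_of_nonneg (hW0 x).le, inv_mul_le_iff₀ (hW0 x)]
        refine (norm_add_le _ _).trans ?_
        have h1 := hbound Z x
        have h2 := le_mul_of_one_le_left (norm_nonneg e) (hW1 x)
        linarith)
  have hT : ContractingWith 2⁻¹ T := by
    refine ⟨by rw [← NNReal.coe_lt_coe]; norm_num, LipschitzWith.of_dist_le_mul fun Z Z' => ?_⟩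
    rw [BoundedContinuousFunction.dist_le (by positivity)]
    intro x
    have hi : ∀ Z : BoundedContinuousFunction ℝ E,
        IntervalIntegrable (fun t => a t (W t • Z t)) volume 0 x := fun Z =>
      intervalIntegrable_iff.2
        (((hint Z).integrableOn_isCompact isCompact_uIcc).mono_set uIoc_subset_uIcc)
    have h1 : (∫ t in (0 : ℝ)..x, a t (W t • Z t)) - ∫ t in (0 : ℝ)..x, a t (W t • Z' t) =
        ∫ t in (0 : ℝ)..x, a t (W t • (Z - Z') t) := by
      rw [← intervalIntegral.integral_sub (hi Z) (hi Z')]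
      simp [smul_sub]
    have h2 := hbound (Z - Z') x
    change dist ((W x)⁻¹ • (e + ∫ t in (0 : ℝ)..x, a t (W t • Z t)))
      ((W x)⁻¹ • (e + ∫ t in (0 : ℝ)..x, a t (W t • Z' t))) ≤ _
    rw [dist_eq_norm, ← smul_sub, add_sub_add_left_eq_sub, h1, norm_smul, norm_inv,
      Real.norm_of_nonneg (hW0 x).le, inv_mul_le_iff₀ (hW0 x), dist_eq_norm]
    refine h2.trans (le_of_eq ?_)
    rw [NNReal.coe_inv, NNReal.coe_ofNat]
    ring
  obtain ⟨Z, hZ⟩ : ∃ Z, T Z = Z := ⟨_, hT.fixedPoint_isFixedPt⟩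
  have hfix : ∀ x, W x • Z x = e + ∫ t in (0 : ℝ)..x, a t (W t • Z t) := by
    intro x
    conv_lhs => rw [← hZ]
    exact smul_inv_smul₀ (hW0 x).ne' _
  refine ⟨fun x => W x • Z x, by simp [hfix 0], ?_⟩
  have := HasACDeriv.of_locallyIntegrable (hint Z) 0 e
  convert this using 2 with x
  exact hfix x

/-- Solutions of `(r z')' = q z`, written as the system `z' = α w`, `w' = q z` with `α = 1 / r`,
with prescribed initial values. -/
theorem exists_solution_system {α q : ℝ → ℝ} (hα : LocallyIntegrable α) (hq : LocallyIntegrable q)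
    (y₀ w₀ : ℝ) : ∃ y w : ℝ → ℝ, y 0 = y₀ ∧ w 0 = w₀ ∧
      HasACDeriv y (fun x => α x * w x) ∧ HasACDeriv w (fun x => q x * y x) := by
  let A : ℝ × ℝ →L[ℝ] ℝ × ℝ :=
    (ContinuousLinearMap.inl ℝ ℝ ℝ).comp (ContinuousLinearMap.snd ℝ ℝ ℝ)
  let B : ℝ × ℝ →L[ℝ] ℝ × ℝ :=
    (ContinuousLinearMap.inr ℝ ℝ ℝ).comp (ContinuousLinearMap.fst ℝ ℝ ℝ)
  have hloc : LocallyIntegrable (fun x => α x • A + q x • B) :=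
    locallyIntegrable_iff.2 fun k hk => ((hα.integrableOn_isCompact hk).smul_const A).add
      ((hq.integrableOn_isCompact hk).smul_const B)
  obtain ⟨Y, hY0, hY⟩ := exists_hasACDeriv_clm hloc (y₀, w₀)
  have hd : ∀ x, (α x • A + q x • B) (Y x) = (α x * (Y x).2, q x * (Y x).1) := by
    intro x; simp [A, B]
  simp only [hd] at hY
  refine ⟨fun x => (Y x).1, fun x => (Y x).2, by simp [hY0], by simp [hY0],
    ⟨hY.1.of_dist_le fun a b => ⟨1, fun x _ y _ => ?_⟩, ?_⟩,
    ⟨hY.1.of_dist_le fun a b => ⟨1, fun x _ y _ => ?_⟩, ?_⟩⟩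
  · rw [one_mul, Prod.dist_eq]; exact le_max_left _ _
  · filter_upwards [hY.2] with x hx using hx.fst
  · rw [one_mul, Prod.dist_eq]; exact le_max_right _ _
  · filter_upwards [hY.2] with x hx using hx.snd

end LinearODE

/-! ### Construction of the distinguished system -/

/-- Where `r > 0` almost everywhere, the equation is the first order system
`y' = w / r`, `w' = q y - f`. -/
theorem isSolutionWith_iff {𝕜 : Type*} [RCLike 𝕜] {r q : ℝ → ℝ} (hr : ∀ᵐ x : ℝ, 0 < r x)
    {f y w : ℝ → 𝕜} : IsSolutionWith r q f y w ↔
      HasACDeriv y (fun x => (1 / r x) • w x) ∧ HasACDeriv w (fun x => q x • y x - f x) := by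
  constructor
  · rintro ⟨hy, hw, h1, h2⟩
    refine ⟨⟨hy, ?_⟩, ⟨hw, ?_⟩⟩
    · filter_upwards [hr, h1] with x hx ⟨hd, hE⟩
      rw [hE, smul_smul, one_div, inv_mul_cancel₀ hx.ne', one_smul]
      exact hd.hasDerivAt
    · filter_upwards [h2] with x ⟨hd, hE⟩
      rw [← hE, sub_add_eq_sub_sub, sub_neg_eq_add, add_comm, add_sub_cancel_right]
      exact hd.hasDerivAt
  · rintro ⟨hy, hw⟩
    refine ⟨hy.1, hw.1, ?_, ?_⟩
    · filter_upwards [hr, hy.2] with x hx hd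
      refine ⟨hd.differentiableAt, ?_⟩
      rw [hd.deriv, smul_smul, one_div, mul_inv_cancel₀ hx.ne', one_smul]
    · filter_upwards [hw.2] with x hd
      refine ⟨hd.differentiableAt, ?_⟩
      rw [hd.deriv]
      abel

section Principal

/-- The energy `y · (r y')` of a homogeneous solution is nondecreasing, since its derivative is
`(r y')² / r + q y²`. -/
theorem monotone_energy {α q y w : ℝ → ℝ} (hα : ∀ᵐ x, 0 < α x) (hq : ∀ᵐ x, 0 ≤ q x)
    (hy : HasACDeriv y (fun x => α x * w x)) (hw : HasACDeriv w (fun x => q x * y x)) :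
    Monotone (fun x => y x * w x) := by
  refine (hy.mul hw).monotone ?_
  filter_upwards [hα, hq] with x h1 h2
  have : α x * w x * w x + y x * (q x * y x) = α x * w x ^ 2 + q x * y x ^ 2 := by ring
  rw [this]
  positivity

/-- The solution with initial values `(1, 0)` is at least `1`: by the energy inequality `c²` is
nonincreasing on the left and nondecreasing on the right of `0`. -/
theorem one_le_of_system {α q c c₁ : ℝ → ℝ} (hα : ∀ᵐ x, 0 < α x) (hq : ∀ᵐ x, 0 ≤ q x)
    (hc : HasACDeriv c (fun x => α x * c₁ x)) (hc₁ : HasACDeriv c₁ (fun x => q x * c x))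
    (h0 : c 0 = 1) (h10 : c₁ 0 = 0) (x : ℝ) : 1 ≤ c x := by
  have hE := monotone_energy hα hq hc hc₁
  have hsq := hc.mul hc
  have h1 : ∀ x, 1 ≤ c x * c x := by
    intro x
    have hI := hsq.integral_eq 0 x
    rw [h0] at hI
    rcases le_total 0 x with hx | hx
    · have : 0 ≤ ∫ t in (0 : ℝ)..x, α t * c₁ t * c t + c t * (α t * c₁ t) := by
        refine intervalIntegral.integral_nonneg_of_ae_restrict hx ?_
        filter_upwards [ae_restrict_mem measurableSet_Icc, ae_restrict_of_ae hα] with t ht hαt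
        have hEt := hE ht.1
        simp only [h10, mul_zero] at hEt
        have := mul_nonneg hαt.le hEt
        simp only [Pi.zero_apply]
        linarith
      linarith
    · have : 0 ≤ ∫ t in x..0, -(α t * c₁ t * c t + c t * (α t * c₁ t)) := by
        refine intervalIntegral.integral_nonneg_of_ae_restrict hx ?_
        filter_upwards [ae_restrict_mem measurableSet_Icc, ae_restrict_of_ae hα] with t ht hαt
        have hEt := hE ht.2
        simp only [h10, mul_zero] at hEt
        have := mul_nonpos_of_nonneg_of_nonpos hαt.le hEt
        simp only [Pi.zero_apply]
        linarith
      rw [intervalIntegral.integral_neg, ← intervalIntegral.integral_symm] at this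
      linarith
  by_contra! hx
  have hneg : c x ≤ -1 := by nlinarith [h1 x]
  obtain ⟨t, -, ht⟩ := isPreconnected_univ.intermediate_value (mem_univ x) (mem_univ 0)
    hc.continuous.continuousOn (show (0 : ℝ) ∈ Icc (c x) (c 0) by rw [h0]; constructor <;> linarith)
  have := h1 t
  rw [ht] at this
  norm_num at this

/-- With `c`, `s` the solutions having initial values `(1, 0)` and `(0, 1)` at `0`, the quotient
`s / c` increases to a finite limit `L` at `+∞`, and `L c - s` is a positive solution with
nonpositive quasi-derivative. The mass of `q` on the right makes `c₁` positive somewhere, which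
bounds `s / c`. -/
theorem exists_limit_quotient {α q c c₁ s s₁ : ℝ → ℝ} (hα : ∀ᵐ x, 0 < α x) (hq : ∀ᵐ x, 0 ≤ q x)
    (hq_right : 0 < ∫⁻ t in Ici (0 : ℝ), ENNReal.ofReal (q t))
    (hc : HasACDeriv c (fun x => α x * c₁ x)) (hc₁ : HasACDeriv c₁ (fun x => q x * c x))
    (hs : HasACDeriv s (fun x => α x * s₁ x)) (hs₁ : HasACDeriv s₁ (fun x => q x * s x))
    (hc0 : c 0 = 1) (hc₁0 : c₁ 0 = 0) (hs0 : s 0 = 0)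
    (hW : ∀ x, s₁ x * c x - c₁ x * s x = 1) :
    ∃ L : ℝ, 0 < L ∧ (∀ x, s x < L * c x) ∧ (∀ x, L * c₁ x ≤ s₁ x) ∧
      Tendsto (fun x => s x / c x) atTop (𝓝 L) := by
  have hc1 := one_le_of_system hα hq hc hc₁ hc0 hc₁0
  have hcp : ∀ x, 0 < c x := fun x => one_pos.trans_le (hc1 x)
  have hg : StrictMono (fun x => s x / c x) := by
    refine (hs.div hc fun x => (hcp x).ne').strictMono ?_
    filter_upwards [hα] with x hx
    have : α x * s₁ x * c x - s x * (α x * c₁ x) = α x := by linear_combination α x * hW x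
    rw [this]
    exact div_pos hx (pow_pos (hcp x) 2)
  -- The solution `s T * c - c T * s` vanishes at `T` and is positive before, so its energy is
  -- nonpositive there, and its quasi-derivative is nonpositive too.
  have hT : ∀ x T, x < T → s T / c T * c₁ x ≤ s₁ x := by
    intro x T hxT
    have hE := monotone_energy hα hq
      (((hc.const_mul (s T)).sub (hs.const_mul (c T))).congr
        (.of_forall fun x => show _ = α x * (s T * c₁ x - c T * s₁ x) by ring))
      (((hc₁.const_mul (s T)).sub (hs₁.const_mul (c T))).congr
        (.of_forall fun x => show _ = q x * (s T * c x - c T * s x) by ring)) hxT.le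
    have h0 : s T * c T - c T * s T = 0 := by ring
    simp only [h0, zero_mul] at hE
    have hlt := hg hxT
    simp only [div_lt_div_iff₀ (hcp x) (hcp T)] at hlt
    have h1 : s T * c₁ x - c T * s₁ x ≤ 0 := by
      by_contra! hpos
      have := mul_pos (show 0 < s T * c x - c T * s x by linarith) hpos
      linarith
    rw [div_mul_eq_mul_div, div_le_iff₀ (hcp T)]
    linarith
  -- Otherwise `c₁` vanishes on `[0, ∞)`, and so does its derivative `q c`.
  obtain ⟨x₀, hx₀⟩ : ∃ x, 0 < c₁ x := by
    by_contra! hle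
    have hE := monotone_energy hα hq hc hc₁
    have hzero : ∀ x, 0 ≤ x → c₁ x = 0 := by
      intro x hx
      have := hE hx
      simp only [hc₁0, mul_zero] at this
      exact le_antisymm (hle x) (nonneg_of_mul_nonneg_right this (hcp x))
    refine hq_right.ne' ?_
    rw [setLIntegral_congr Ioi_ae_eq_Ici.symm,
      ← lintegral_zero (μ := volume.restrict (Ioi (0 : ℝ)))]
    refine lintegral_congr_ae ?_
    filter_upwards [ae_restrict_mem measurableSet_Ioi, ae_restrict_of_ae hc₁.2] with x hx hd
    have hloc : c₁ =ᶠ[𝓝 x] fun _ => 0 := by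
      filter_upwards [Ioi_mem_nhds hx] with y hy using hzero y (le_of_lt hy)
    have h0 := (hd.congr_of_eventuallyEq hloc.symm).unique (hasDerivAt_const x 0)
    rw [(mul_eq_zero.1 h0).resolve_right (hcp x).ne', ENNReal.ofReal_zero]
  have hbdd : BddAbove (range fun x => s x / c x) := by
    refine ⟨s₁ x₀ / c₁ x₀, ?_⟩
    rintro _ ⟨x, rfl⟩
    have h1 := hT x₀ (max x x₀ + 1) (by linarith [le_max_right x x₀])
    have h2 := hg (show x < max x x₀ + 1 by linarith [le_max_left x x₀])
    exact h2.le.trans ((le_div_iff₀ hx₀).2 h1)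
  have hlt : ∀ x, s x / c x < ⨆ x, s x / c x := fun x =>
    (hg (lt_add_one x)).trans_le (le_ciSup hbdd (x + 1))
  have hlim := tendsto_atTop_ciSup hg.monotone hbdd
  refine ⟨⨆ x, s x / c x, by simpa [hs0] using hlt 0, fun x => (div_lt_iff₀ (hcp x)).1 (hlt x),
    fun x => ?_, hlim⟩
  exact le_of_tendsto (hlim.mul_const (c₁ x))
    ((eventually_gt_atTop x).mono fun T h => hT x T h)

/-- The system is `u = L c - s`, `v = (s + M c) / (L + M)`, where `L` and `-M` are the limits of
`s / c` at `+∞` and `-∞`. -/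
theorem exists_isPrincipalSystem {r q : ℝ → ℝ}
    (hr : ∀ᵐ x : ℝ, 0 < r x) (hq : ∀ᵐ x : ℝ, 0 ≤ q x)
    (hr_loc : LocallyIntegrable (fun x => 1 / r x) volume)
    (hq_loc : LocallyIntegrable q volume)
    (hq_left : 0 < ∫⁻ t in Iic (0 : ℝ), ENNReal.ofReal (q t))
    (hq_right : 0 < ∫⁻ t in Ici (0 : ℝ), ENNReal.ofReal (q t)) :
    ∃ u v : ℝ → ℝ, IsPrincipalSystem r q u v := by
  have hα : ∀ᵐ x, 0 < 1 / r x := hr.mono fun x hx => one_div_pos.2 hx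
  obtain ⟨c, c₁, hc0, hc₁0, hc, hc₁⟩ := exists_solution_system hr_loc hq_loc 1 0
  obtain ⟨s, s₁, hs0, hs₁0, hs, hs₁⟩ := exists_solution_system hr_loc hq_loc 0 1
  have hcp : ∀ x, 0 < c x := fun x =>
    one_pos.trans_le (one_le_of_system hα hq hc hc₁ hc0 hc₁0 x)
  have hW : ∀ x, s₁ x * c x - c₁ x * s x = 1 := by
    intro x
    have := (((hs₁.mul hc).sub (hc₁.mul hs)).congr
      (G' := fun _ => 0) (.of_forall fun x => by ring)).eq_of_zero x 0
    simp only [hc0, hc₁0, hs0, hs₁0] at this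
    linarith
  obtain ⟨L, hL0, hL1, hL2, hL3⟩ :=
    exists_limit_quotient hα hq hq_right hc hc₁ hs hs₁ hc0 hc₁0 hs0 hW
  -- The left end is the right end of the reflected equation; `s` and `c₁` change sign, and
  -- `s / c` tends to `-M` at `-∞`.
  obtain ⟨M, hM0, hM1, hM2, hM3⟩ := exists_limit_quotient
    (α := fun x => 1 / r (-x)) (q := fun x => q (-x)) (c := fun x => c (-x))
    (c₁ := fun x => -c₁ (-x)) (s := fun x => -s (-x)) (s₁ := fun x => s₁ (-x))
    (ae_comp_neg hα) (ae_comp_neg hq)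
    (by rwa [lintegral_Iic_eq_lintegral_Ici_neg, neg_zero] at hq_left)
    (hc.comp_neg.congr (.of_forall fun x => by ring))
    (hc₁.comp_neg.neg.congr (.of_forall fun x => by ring))
    (hs.comp_neg.neg.congr (.of_forall fun x => by ring))
    (hs₁.comp_neg.congr (.of_forall fun x => by ring))
    (by simpa) (by simpa) (by simpa) (fun x => by linear_combination hW (-x))
  have hbot : Tendsto (fun x => s x / c x) atBot (𝓝 (-M)) := by
    refine ((hM3.comp tendsto_neg_atBot_atTop).neg).congr fun x => ?_
    simp [neg_div]
  have hLM : 0 < L + M := by positivity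
  set u : ℝ → ℝ := fun x => L * c x - s x with hu
  set v : ℝ → ℝ := fun x => (L + M)⁻¹ * (s x + M * c x) with hv
  set u₁ : ℝ → ℝ := fun x => L * c₁ x - s₁ x with hu₁
  set v₁ : ℝ → ℝ := fun x => (L + M)⁻¹ * (s₁ x + M * c₁ x) with hv₁
  have hup : ∀ x, 0 < u x := fun x => sub_pos.2 (hL1 x)
  have hvp : ∀ x, 0 < v x := fun x => by
    have := hM1 (-x)
    simp only [neg_neg] at this
    exact mul_pos (inv_pos.2 hLM) (by linarith)
  have hud : HasACDeriv u (fun x => 1 / r x * u₁ x) :=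
    ((hc.const_mul L).sub hs).congr (.of_forall fun x => by simp only [hu₁]; ring)
  have hu₁d : HasACDeriv u₁ (fun x => q x * u x) :=
    ((hc₁.const_mul L).sub hs₁).congr (.of_forall fun x => by simp only [hu]; ring)
  have hvd : HasACDeriv v (fun x => 1 / r x * v₁ x) :=
    ((hs.add (hc.const_mul M)).const_mul _).congr (.of_forall fun x => by simp only [hv₁]; ring)
  have hv₁d : HasACDeriv v₁ (fun x => q x * v x) :=
    ((hs₁.add (hc₁.const_mul M)).const_mul _).congr (.of_forall fun x => by simp only [hv]; ring)
  have hWr : ∀ x, v₁ x * u x - u₁ x * v x = 1 := by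
    intro x
    have : v₁ x * u x - u₁ x * v x =
        (L + M)⁻¹ * (L + M) * (s₁ x * c x - c₁ x * s x) := by
      simp only [hu, hv, hu₁, hv₁]; ring
    rw [this, hW, inv_mul_cancel₀ hLM.ne', one_mul]
  have hvu_eq : ∀ x, v x / u x = (L + M)⁻¹ * (s x / c x + M) / (L - s x / c x) := by
    intro x
    have h1 := (hcp x).ne'
    have h2 : L - s x / c x = u x / c x := by simp only [hu]; field_simp
    have h3 := (hup x).ne'
    rw [h2]
    simp only [hv]
    field_simp
  have huv_eq : ∀ x, u x / v x = (L + M) * (L - s x / c x) / (s x / c x + M) := by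
    intro x
    rw [← inv_div, hvu_eq, inv_div, mul_comm (L + M)⁻¹, ← div_div, div_inv_eq_mul]
    ring
  have htb : Tendsto (fun x => v x / u x) atBot (𝓝 0) := by
    have := ((hbot.add_const M).const_mul (L + M)⁻¹).div (hbot.const_sub L) (by linarith)
    simp only [neg_add_cancel, mul_zero, zero_div] at this
    exact this.congr fun x => (hvu_eq x).symm
  have htt : Tendsto (fun x => u x / v x) atTop (𝓝 0) := by
    have := ((hL3.const_sub L).const_mul (L + M)).div (hL3.add_const M) hLM.ne'
    simp only [sub_self, mul_zero, zero_div] at this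
    exact this.congr fun x => (huv_eq x).symm
  -- Both integrands are derivatives of quotients, by the Wronskian identity
  have hvud : HasACDeriv (fun x => v x / u x) (fun x => 1 / (r x * u x ^ 2)) := by
    refine (hvd.div hud fun x => (hup x).ne').congr (.of_forall fun x => ?_)
    have : 1 / r x * v₁ x * u x - v x * (1 / r x * u₁ x) = 1 / r x := by
      linear_combination 1 / r x * hWr x
    simp only [this, div_div]
  have huvd : HasACDeriv (fun x => -(u x / v x)) (fun x => 1 / (r x * v x ^ 2)) := by
    refine (hud.div hvd fun x => (hvp x).ne').neg.congr (.of_forall fun x => ?_)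
    have : 1 / r x * u₁ x * v x - u x * (1 / r x * v₁ x) = -(1 / r x) := by
      linear_combination -1 / r x * hWr x
    simp only [this, neg_div, neg_neg, div_div]
  have hnu : ∀ᵐ x, 0 ≤ 1 / (r x * u x ^ 2) := hr.mono fun x hx => by positivity
  have hnv : ∀ᵐ x, 0 ≤ 1 / (r x * v x ^ 2) := hr.mono fun x hx => by positivity
  refine ⟨u, v, u₁, v₁, (isSolutionWith_iff hr).2 ⟨by simpa using hud, by simpa using hu₁d⟩,
    (isSolutionWith_iff hr).2 ⟨by simpa using hvd, by simpa using hv₁d⟩, hup, hvp,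
    fun x => sub_nonpos.2 (hL2 x), fun x => ?_, hWr, htb, htt, ?_, ?_, ?_, ?_⟩
  · have := hM2 (-x)
    simp only [neg_neg, mul_neg] at this
    exact mul_nonneg (inv_nonneg.2 hLM.le) (by linarith)
  · refine huvd.lintegral_Iic_eq_top hnv 0 (tendsto_neg_atTop_atBot.comp ?_)
    refine (Tendsto.inv_tendsto_nhdsGT_zero (tendsto_nhdsWithin_iff.2 ⟨htb, .of_forall fun x =>
      div_pos (hvp x) (hup x)⟩)).congr fun x => by simp
  · refine hvud.lintegral_Ici_eq_top hnu 0 ?_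
    refine (Tendsto.inv_tendsto_nhdsGT_zero (tendsto_nhdsWithin_iff.2 ⟨htt, .of_forall fun x =>
      div_pos (hup x) (hvp x)⟩)).congr fun x => by simp
  · exact huvd.lintegral_Ici_lt_top hnv (C := 0) fun x =>
      neg_nonpos.2 (div_pos (hup x) (hvp x)).le
  · exact hvud.lintegral_Iic_lt_top hnu (C := 0) fun x => (div_pos (hvp x) (hup x)).le

end Principal

/-! ### Homogeneous solutions in `L_p` -/

variable {𝕜 : Type*} [RCLike 𝕜]

section Homogeneous

theorem IsSolutionWith.sub {r q : ℝ → ℝ} (hr : ∀ᵐ x : ℝ, 0 < r x) {f y w y' w' : ℝ → 𝕜}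
    (h : IsSolutionWith r q f y w) (h' : IsSolutionWith r q f y' w') :
    IsSolutionWith r q 0 (fun x => y x - y' x) (fun x => w x - w' x) := by
  rw [isSolutionWith_iff hr] at *
  exact ⟨(h.1.sub h'.1).congr (.of_forall fun x => (smul_sub _ _ _).symm),
    (h.2.sub h'.2).congr (.of_forall fun x => by simp [smul_sub])⟩

namespace IsPrincipalSystemWith

variable {r q u v u₁ v₁ : ℝ → ℝ}

theorem hasACDeriv (hr : ∀ᵐ x : ℝ, 0 < r x) (h : IsPrincipalSystemWith r q u v u₁ v₁) :
    HasACDeriv u (fun x => 1 / r x * u₁ x) ∧ HasACDeriv u₁ (fun x => q x * u x) ∧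
    HasACDeriv v (fun x => 1 / r x * v₁ x) ∧ HasACDeriv v₁ (fun x => q x * v x) := by
  obtain ⟨h1, h2⟩ := (isSolutionWith_iff hr).1 h.sol_u
  obtain ⟨h3, h4⟩ := (isSolutionWith_iff hr).1 h.sol_v
  exact ⟨h1, by simpa using h2, h3, by simpa using h4⟩

theorem antitone_u (hr : ∀ᵐ x : ℝ, 0 < r x) (h : IsPrincipalSystemWith r q u v u₁ v₁) :
    Antitone u := by
  have := (h.hasACDeriv hr).1.neg.monotone (hr.mono fun x hx => neg_nonneg.2
    (mul_nonpos_of_nonneg_of_nonpos (one_div_pos.2 hx).le (h.deriv_u x)))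
  intro a b hab
  linarith [this hab]

theorem monotone_v (hr : ∀ᵐ x : ℝ, 0 < r x) (h : IsPrincipalSystemWith r q u v u₁ v₁) :
    Monotone v :=
  (h.hasACDeriv hr).2.2.1.monotone (hr.mono fun x hx =>
    mul_nonneg (one_div_pos.2 hx).le (h.deriv_v x))

/-- The coefficients are the Wronskians of the solution with `v` and with `u`. -/
theorem exists_eq_smul_add_smul (hr : ∀ᵐ x : ℝ, 0 < r x)
    (h : IsPrincipalSystemWith r q u v u₁ v₁) {z w : ℝ → 𝕜} (hz : IsSolutionWith r q 0 z w) :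
    ∃ a b : 𝕜, ∀ x, z x = u x • a + v x • b := by
  obtain ⟨hu, hu₁, hv, hv₁⟩ := h.hasACDeriv hr
  obtain ⟨hz, hw⟩ := (isSolutionWith_iff hr).1 hz
  have ha := (((hv₁.smul hz).sub (hv.smul hw)).congr (G' := fun _ => 0)
    (.of_forall fun x => by simp only [Pi.zero_apply]; module)).eq_of_zero
  have hb := (((hu.smul hw).sub (hu₁.smul hz)).congr (G' := fun _ => 0)
    (.of_forall fun x => by simp only [Pi.zero_apply]; module)).eq_of_zero
  refine ⟨v₁ 0 • z 0 - v 0 • w 0, u 0 • w 0 - u₁ 0 • z 0, fun x => ?_⟩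
  rw [ha 0 x, hb 0 x]
  calc z x = (v₁ x * u x - u₁ x * v x) • z x := by rw [h.wronskian, one_smul]
    _ = _ := by module

end IsPrincipalSystemWith

theorem not_memLp_of_le_norm {p : ℝ≥0∞} (hp : p ≠ 0) (hp' : p ≠ ∞) {h : ℝ → 𝕜} {S : Set ℝ}
    (hS : volume S = ∞) {δ : ℝ} (hδ : 0 < δ) (hle : ∀ x ∈ S, δ ≤ ‖h x‖) :
    ¬ MemLp h p volume := by
  intro hh
  have h1 := hh.meas_ge_lt_top hp hp' (ε := δ.toNNReal) (by simpa using hδ)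
  refine (h1.trans_le' (measure_mono fun x hx => ?_)).ne hS
  have := hle x hx
  exact Real.toNNReal_le_iff_le_coe.2 (by simpa using this)

namespace IsPrincipalSystemWith

variable {r q u v u₁ v₁ : ℝ → ℝ} {p : ℝ≥0∞}

/-- Near `+∞` the nondecreasing solution `v` dominates `u`, so it cannot enter a function in
`L_p`. -/
theorem coeff_v_eq_zero (hr : ∀ᵐ x : ℝ, 0 < r x) (h : IsPrincipalSystemWith r q u v u₁ v₁)
    (hp : p ≠ 0) (hp' : p ≠ ∞) {y : ℝ → 𝕜} (hy : MemLp y p volume) {a b : 𝕜} {N : ℝ}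
    (hN : ∀ x, N ≤ x → y x = u x • a + v x • b) : b = 0 := by
  by_contra hb
  have hb' : 0 < ‖b‖ := norm_pos_iff.2 hb
  have hlim : Tendsto (fun x => u x / v x * ‖a‖) atTop (𝓝 0) := by
    simpa using h.tendsto_top.mul_const ‖a‖
  obtain ⟨M, hM⟩ := eventually_atTop.1 (hlim.eventually (gt_mem_nhds (half_pos hb')))
  refine not_memLp_of_le_norm hp hp' (S := Ici (max N M)) Real.volume_Ici
    (δ := v (max N M) * (‖b‖ / 2)) (mul_pos (h.pos_v _) (half_pos hb')) (fun x hx => ?_) hy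
  have h1 := hM x ((le_max_right _ _).trans hx)
  rw [div_mul_eq_mul_div, div_lt_iff₀ (h.pos_v x)] at h1
  have h2 := mul_le_mul_of_nonneg_right (h.monotone_v hr hx) (half_pos hb').le
  have h3 := norm_sub_le (u x • a + v x • b) (u x • a)
  rw [add_sub_cancel_left, norm_smul, norm_smul, Real.norm_of_nonneg (h.pos_v x).le,
    Real.norm_of_nonneg (h.pos_u x).le] at h3
  rw [hN x ((le_max_left _ _).trans hx)]
  linarith

/-- Near `-∞` the nonincreasing solution `u` dominates `v`, so it cannot enter a function in
`L_p`. -/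
theorem coeff_u_eq_zero (hr : ∀ᵐ x : ℝ, 0 < r x) (h : IsPrincipalSystemWith r q u v u₁ v₁)
    (hp : p ≠ 0) (hp' : p ≠ ∞) {y : ℝ → 𝕜} (hy : MemLp y p volume) {a b : 𝕜} {N : ℝ}
    (hN : ∀ x, x ≤ N → y x = u x • a + v x • b) : a = 0 := by
  by_contra ha
  have ha' : 0 < ‖a‖ := norm_pos_iff.2 ha
  have hlim : Tendsto (fun x => v x / u x * ‖b‖) atBot (𝓝 0) := by
    simpa using h.tendsto_bot.mul_const ‖b‖
  obtain ⟨M, hM⟩ := eventually_atBot.1 (hlim.eventually (gt_mem_nhds (half_pos ha')))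
  refine not_memLp_of_le_norm hp hp' (S := Iic (min N M)) Real.volume_Iic
    (δ := u (min N M) * (‖a‖ / 2)) (mul_pos (h.pos_u _) (half_pos ha')) (fun x hx => ?_) hy
  have h1 := hM x (le_trans hx (min_le_right _ _))
  rw [div_mul_eq_mul_div, div_lt_iff₀ (h.pos_u x)] at h1
  have h2 := mul_le_mul_of_nonneg_right (h.antitone_u hr hx) (half_pos ha').le
  have h3 := norm_sub_le (u x • a + v x • b) (v x • b)
  rw [add_sub_cancel_right, norm_smul, norm_smul, Real.norm_of_nonneg (h.pos_v x).le,
    Real.norm_of_nonneg (h.pos_u x).le] at h3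
  rw [hN x (le_trans hx (min_le_left _ _))]
  linarith

/-- The homogeneous equation has no nonzero solution in `L_p`, so `L_p`-solutions are unique. -/
theorem eq_of_isSolution (hr : ∀ᵐ x : ℝ, 0 < r x) (h : IsPrincipalSystemWith r q u v u₁ v₁)
    (hp : p ≠ 0) (hp' : p ≠ ∞) {f y z : ℝ → 𝕜} (hy : IsSolution r q f y) (hyp : MemLp y p volume)
    (hz : IsSolution r q f z) (hzp : MemLp z p volume) : y = z := by
  obtain ⟨w, hw⟩ := hy
  obtain ⟨w', hw'⟩ := hz
  obtain ⟨a, b, hab⟩ := h.exists_eq_smul_add_smul hr (hw.sub hr hw')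
  have hb := h.coeff_v_eq_zero hr hp hp' (hyp.sub hzp) (N := 0) fun x _ => hab x
  have ha := h.coeff_u_eq_zero hr hp hp' (hyp.sub hzp) (N := 0) fun x _ => hab x
  funext x
  have := hab x
  rw [ha, hb, smul_zero, smul_zero, add_zero] at this
  exact sub_eq_zero.1 this

end IsPrincipalSystemWith

end Homogeneous

/-! ### The Green operator -/

section Green

variable {u v : ℝ → ℝ} {f : ℝ → 𝕜}

theorem greenKernel_pos (hu : ∀ x, 0 < u x) (hv : ∀ x, 0 < v x) (x t : ℝ) :
    0 < greenKernel u v x t := by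
  unfold greenKernel
  split_ifs
  exacts [mul_pos (hu x) (hv t), mul_pos (hu t) (hv x)]

theorem greenKernel_smul_of_mem_Iic {x t : ℝ} (ht : t ∈ Iic x) :
    greenKernel u v x t • f t = u x • v t • f t := by
  rw [greenKernel, if_pos (mem_Iic.1 ht), mul_smul]

theorem greenKernel_smul_of_mem_Ioi {x t : ℝ} (ht : t ∈ Ioi x) :
    greenKernel u v x t • f t = v x • u t • f t := by
  rw [greenKernel, if_neg (not_le.2 (mem_Ioi.1 ht)), mul_comm, mul_smul]

/-- The weighted tails of `f` are integrable; this is what absolute convergence of the Green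
integral at every point amounts to. -/
def TailsIntegrable (u v : ℝ → ℝ) (f : ℝ → 𝕜) : Prop :=
  ∀ x, IntegrableOn (fun t => v t • f t) (Iic x) ∧ IntegrableOn (fun t => u t • f t) (Ioi x)

theorem integrable_greenKernel_iff (hu : ∀ x, 0 < u x) (hv : ∀ x, 0 < v x) (x : ℝ) :
    Integrable (fun t => greenKernel u v x t • f t) ↔
      IntegrableOn (fun t => v t • f t) (Iic x) ∧ IntegrableOn (fun t => u t • f t) (Ioi x) := by
  rw [← integrableOn_univ, ← Iic_union_Ioi (a := x), integrableOn_union,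
    integrableOn_congr_fun (fun t ht => greenKernel_smul_of_mem_Iic ht) measurableSet_Iic,
    integrableOn_congr_fun (fun t ht => greenKernel_smul_of_mem_Ioi ht) measurableSet_Ioi]
  exact and_congr (integrable_smul_iff (hu x).ne' _) (integrable_smul_iff (hv x).ne' _)

theorem locallyIntegrable_continuous_smul {g : ℝ → ℝ} (hg : Continuous g)
    (hf : LocallyIntegrable f) : LocallyIntegrable (fun t => g t • f t) :=
  locallyIntegrable_iff.2 fun _ hk =>
    (hf.integrableOn_isCompact hk).continuousOn_smul hg.continuousOn hk

/-- Absolute convergence of the Green integral at one point implies it at all points. -/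
theorem TailsIntegrable.of_integrable (hu : ∀ x, 0 < u x) (hv : ∀ x, 0 < v x)
    (huc : Continuous u) (hvc : Continuous v) (hf : LocallyIntegrable f) {x₀ : ℝ}
    (h : Integrable (fun t => greenKernel u v x₀ t • f t)) : TailsIntegrable u v f := by
  obtain ⟨h1, h2⟩ := (integrable_greenKernel_iff hu hv x₀).1 h
  refine fun x => ⟨?_, ?_⟩
  · have h3 := (locallyIntegrable_continuous_smul hvc hf).integrableOn_isCompact
      (isCompact_Icc (a := x₀) (b := x))
    refine (h1.union h3).mono_set fun t ht => ?_
    rcases le_total t x₀ with h | h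
    exacts [Or.inl h, Or.inr ⟨h, ht⟩]
  · have h3 := (locallyIntegrable_continuous_smul huc hf).integrableOn_isCompact
      (isCompact_Icc (a := x) (b := x₀))
    refine (h2.union h3).mono_set fun t ht => ?_
    rcases lt_or_ge x₀ t with h | h
    exacts [Or.inl h, Or.inr ⟨le_of_lt ht, h⟩]

theorem TailsIntegrable.greenOp_eq (hu : ∀ x, 0 < u x) (hv : ∀ x, 0 < v x)
    (h : TailsIntegrable u v f) (x : ℝ) :
    greenOp u v f x = u x • (∫ t in Iic x, v t • f t) + v x • ∫ t in Ioi x, u t • f t := by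
  have hi := (integrable_greenKernel_iff hu hv x).2 (h x)
  rw [greenOp, ← intervalIntegral.integral_Iic_add_Ioi (b := x) hi.integrableOn hi.integrableOn,
    setIntegral_congr_fun measurableSet_Iic (fun t ht => greenKernel_smul_of_mem_Iic ht),
    setIntegral_congr_fun measurableSet_Ioi (fun t ht => greenKernel_smul_of_mem_Ioi ht),
    integral_smul, integral_smul]

/-- Variation of constants: the terms with `f` in the derivative of `Gf` cancel, and those in the
derivative of its quasi-derivative add up to `-f` by the Wronskian identity. -/
theorem IsPrincipalSystemWith.isSolution_greenOp {r q u₁ v₁ : ℝ → ℝ}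
    (hr : ∀ᵐ x : ℝ, 0 < r x) (h : IsPrincipalSystemWith r q u v u₁ v₁)
    (hf : LocallyIntegrable f) (ht : TailsIntegrable u v f) :
    IsSolution r q f (greenOp u v f) := by
  obtain ⟨hu, hu₁, hv, hv₁⟩ := h.hasACDeriv hr
  have hP : HasACDeriv (fun x => ∫ t in Iic x, v t • f t) (fun x => v x • f x) := by
    convert HasACDeriv.of_locallyIntegrable (locallyIntegrable_continuous_smul hv.continuous hf) 0
      (∫ t in Iic 0, v t • f t) using 2 with x
    rw [← intervalIntegral.integral_Iic_sub_Iic (ht 0).1 (ht x).1, add_sub_cancel]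
  have hR : HasACDeriv (fun x => ∫ t in Ioi x, u t • f t) (fun x => -(u x • f x)) := by
    convert (HasACDeriv.of_locallyIntegrable (locallyIntegrable_continuous_smul hu.continuous hf) 0
      (-∫ t in Ioi 0, u t • f t)).neg using 2 with x
    rw [← intervalIntegral.integral_Ioi_sub_Ioi' (ht 0).2 (ht x).2]
    abel
  rw [funext (ht.greenOp_eq h.pos_u h.pos_v)]
  refine ⟨fun x => u₁ x • (∫ t in Iic x, v t • f t) + v₁ x • ∫ t in Ioi x, u t • f t,
    (isSolutionWith_iff hr).2 ⟨((hu.smul hP).add (hv.smul hR)).congr (.of_forall fun x => ?_),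
      ((hu₁.smul hP).add (hv₁.smul hR)).congr (.of_forall fun x => ?_)⟩⟩
  · module
  · have : f x = (v₁ x * u x - u₁ x * v x) • f x := by rw [h.wronskian, one_smul]
    dsimp only
    rw [eq_sub_iff_add_eq]
    nth_rw 3 [this]
    module

theorem TailsIntegrable.of_support (huc : Continuous u) (hvc : Continuous v)
    (hf : LocallyIntegrable f) {n : ℝ} (hs : ∀ t, t ∉ Icc (-n) n → f t = 0) :
    TailsIntegrable u v f := by
  have hi : ∀ g : ℝ → ℝ, Continuous g → Integrable (fun t => g t • f t) := fun g hg => by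
    rw [← integrableOn_iff_integrable_of_support_subset (s := Icc (-n) n)]
    · exact (locallyIntegrable_continuous_smul hg hf).integrableOn_isCompact isCompact_Icc
    · intro t ht
      by_contra hn
      exact ht (by simp [hs t hn])
  exact fun x => ⟨(hi v hvc).integrableOn, (hi u huc).integrableOn⟩

/-- For compactly supported data the `L_p`-solution is the Green integral: beyond the support
`Gf` is a multiple of `u` on the right and of `v` on the left, and the difference of two solutions
is `a u + b v`, so membership in `L_p` forces `b = 0` and `a = 0`. -/
theorem IsPrincipalSystemWith.eq_greenOp_of_support {r q u₁ v₁ : ℝ → ℝ}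
    (hr : ∀ᵐ x : ℝ, 0 < r x) (h : IsPrincipalSystemWith r q u v u₁ v₁) {p : ℝ≥0∞}
    (hp : p ≠ 0) (hp' : p ≠ ∞) (hf : LocallyIntegrable f) {n : ℝ}
    (hs : ∀ t, t ∉ Icc (-n) n → f t = 0) {y : ℝ → 𝕜} (hy : IsSolution r q f y)
    (hyp : MemLp y p volume) : y = greenOp u v f := by
  obtain ⟨hu, -, hv, -⟩ := h.hasACDeriv hr
  have ht := TailsIntegrable.of_support hu.continuous hv.continuous hf hs
  obtain ⟨w, hw⟩ := hy
  obtain ⟨w', hw'⟩ := h.isSolution_greenOp hr hf ht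
  obtain ⟨a, b, hab⟩ := h.exists_eq_smul_add_smul hr (hw.sub hr hw')
  have hG := ht.greenOp_eq h.pos_u h.pos_v
  have hright : ∀ x, n ≤ x → greenOp u v f x = u x • ∫ t, v t • f t := by
    intro x hx
    rw [hG x, setIntegral_eq_integral_of_forall_compl_eq_zero,
      setIntegral_eq_zero_of_forall_eq_zero, smul_zero, add_zero]
    · intro t htx
      rw [hs t fun hm => ?_, smul_zero]
      exact (hx.trans_lt htx).not_ge hm.2
    · intro t htx
      rw [hs t fun hm => ?_, smul_zero]
      exact htx (hm.2.trans hx)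
  have hleft : ∀ x, x ≤ -n - 1 → greenOp u v f x = v x • ∫ t, u t • f t := by
    intro x hx
    rw [hG x, setIntegral_eq_zero_of_forall_eq_zero,
      setIntegral_eq_integral_of_forall_compl_eq_zero, smul_zero, zero_add]
    · intro t htx
      rw [hs t fun hm => ?_, smul_zero]
      have := hm.1
      exact htx (show x < t by linarith)
    · intro t htx
      rw [hs t fun hm => ?_, smul_zero]
      have := hm.1
      have : t ≤ x := htx
      linarith
  have hb : b = 0 := h.coeff_v_eq_zero hr hp hp' hyp (a := a + ∫ t, v t • f t) (N := n)
    fun x hx => by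
      rw [← sub_add_cancel (y x) (greenOp u v f x), hab, hright x hx]
      module
  have ha : a = 0 := h.coeff_u_eq_zero hr hp hp' hyp (b := b + ∫ t, u t • f t) (N := -n - 1)
    fun x hx => by
      rw [← sub_add_cancel (y x) (greenOp u v f x), hab, hleft x hx]
      module
  funext x
  have := hab x
  rw [ha, hb, smul_zero, smul_zero, add_zero] at this
  exact sub_eq_zero.1 this

/-! ### Correct solvability and boundedness -/

theorem IsSolution.continuous {r q : ℝ → ℝ} {y : ℝ → 𝕜} (h : IsSolution r q f y) :
    Continuous y := h.choose_spec.ac.continuous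

theorem IsPrincipalSystemWith.correctlySolvable_of_greenBounded {r q u₁ v₁ : ℝ → ℝ}
    (hr : ∀ᵐ x : ℝ, 0 < r x) (h : IsPrincipalSystemWith r q u v u₁ v₁) {p : ℝ≥0∞}
    (hp : 1 ≤ p) (hp' : p ≠ ∞) (hG : GreenBounded 𝕜 u v p) : CorrectlySolvable 𝕜 r q p := by
  have hp0 : p ≠ 0 := (one_pos.trans_le hp).ne'
  obtain ⟨hG, C, hC⟩ := hG
  have hsol : ∀ f : ℝ → 𝕜, MemLp f p volume → IsSolution r q f (greenOp u v f) := fun f hf =>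
    h.isSolution_greenOp hr (hf.locallyIntegrable hp)
      fun x => (integrable_greenKernel_iff h.pos_u h.pos_v x).1 ((hG f hf).1 x)
  refine ⟨fun f hf => ⟨greenOp u v f, ⟨hsol f hf, (hG f hf).2⟩, fun y hy => ?_⟩,
    C + 1, by positivity, fun f y hf hy hyp => ?_⟩
  · exact h.eq_of_isSolution hr hp0 hp' hy.1 hy.2 (hsol f hf) (hG f hf).2
  · rw [h.eq_of_isSolution hr hp0 hp' hy hyp (hsol f hf) (hG f hf).2]
    refine (hC f hf).trans ?_
    gcongr
    simp

/-- Monotone convergence for `L_p` seminorms. -/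
theorem eLpNorm_iSup_le {p : ℝ≥0∞} (hp : p ≠ 0) (hp' : p ≠ ∞) {H : ℕ → ℝ → ℝ≥0∞}
    (hH : ∀ n, AEMeasurable (H n)) (hmono : Monotone H) {B : ℝ≥0∞}
    (hB : ∀ n, eLpNorm (H n) p volume ≤ B) : eLpNorm (fun x => ⨆ n, H n x) p volume ≤ B := by
  have hp0 : 0 < p.toReal := ENNReal.toReal_pos hp hp'
  have hlim : Tendsto (fun n => ∫⁻ x, H n x ^ p.toReal) atTop
      (𝓝 (∫⁻ x, (⨆ n, H n x) ^ p.toReal)) := by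
    refine lintegral_tendsto_of_tendsto_of_monotone (fun n => (hH n).pow_const _)
      (.of_forall fun x m n hmn => ENNReal.rpow_le_rpow (hmono hmn x) hp0.le)
      (.of_forall fun x => ?_)
    exact (ENNReal.continuous_rpow_const.tendsto _).comp
      (tendsto_atTop_iSup fun m n hmn => hmono hmn x)
  rw [eLpNorm_eq_lintegral_rpow_enorm_toReal hp hp', one_div, ENNReal.rpow_inv_le_iff hp0]
  refine le_of_tendsto' hlim fun n => ?_
  have := hB n
  rwa [eLpNorm_eq_lintegral_rpow_enorm_toReal hp hp', one_div, ENNReal.rpow_inv_le_iff hp0] at this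

/-- The Green integral of the modulus of `f`, as an extended nonnegative number. -/
noncomputable def greenMajorant (u v : ℝ → ℝ) (f : ℝ → 𝕜) (x : ℝ) : ℝ≥0∞ :=
  ∫⁻ t, ‖greenKernel u v x t • f t‖ₑ

theorem enorm_greenOp_norm (hu : ∀ x, 0 < u x) (hv : ∀ x, 0 < v x) {x : ℝ}
    (h : Integrable (fun t => greenKernel u v x t • f t)) :
    ‖greenOp u v (fun t => ((‖f t‖ : ℝ) : 𝕜)) x‖ₑ = greenMajorant u v f x := by
  have hk : ∀ t, greenKernel u v x t • ((‖f t‖ : ℝ) : 𝕜) =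
      ((‖greenKernel u v x t • f t‖ : ℝ) : 𝕜) := fun t => by
    rw [norm_smul, Real.norm_of_nonneg (greenKernel_pos hu hv x t).le, RCLike.real_smul_eq_coe_mul,
      RCLike.ofReal_mul]
  rw [greenOp, funext hk, integral_ofReal, ← ofReal_norm, RCLike.norm_ofReal,
    abs_of_nonneg (integral_nonneg fun t => norm_nonneg _),
    ofReal_integral_norm_eq_lintegral_enorm h, greenMajorant]

theorem greenMajorant_indicator (f : ℝ → 𝕜) (n : ℕ) (x : ℝ) :
    greenMajorant u v ((Icc (-n : ℝ) n).indicator f) x =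
      ∫⁻ t in Icc (-n : ℝ) n, ‖greenKernel u v x t • f t‖ₑ := by
  rw [greenMajorant, ← lintegral_indicator measurableSet_Icc]
  refine lintegral_congr fun t => ?_
  by_cases ht : t ∈ Icc (-n : ℝ) n <;> simp [ht]

theorem monotone_Icc_neg_natCast : Monotone fun n : ℕ => Icc (-n : ℝ) n := fun m n hmn =>
  Icc_subset_Icc (by simpa using hmn) (by simpa using hmn)

theorem monotone_greenMajorant_indicator (f : ℝ → 𝕜) :
    Monotone (fun n : ℕ => greenMajorant u v ((Icc (-n : ℝ) n).indicator f)) := by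
  intro m n hmn x
  simp only [greenMajorant_indicator]
  exact lintegral_mono_set (monotone_Icc_neg_natCast hmn)

theorem iSup_greenMajorant_indicator (f : ℝ → 𝕜) (x : ℝ) :
    ⨆ n : ℕ, greenMajorant u v ((Icc (-n : ℝ) n).indicator f) x = greenMajorant u v f x := by
  have hU : ⋃ n : ℕ, Icc (-n : ℝ) n = univ := by
    refine eq_univ_of_forall fun t => mem_iUnion.2 ?_
    obtain ⟨n, hn⟩ := exists_nat_ge |t|
    exact ⟨n, abs_le.1 hn⟩
  simp only [greenMajorant_indicator]
  rw [← setLIntegral_iUnion_of_directed _ monotone_Icc_neg_natCast.directed_le, hU,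
    setLIntegral_univ, greenMajorant]

/-- Truncations of `|f|` have Green integrals bounded in `L_p` by the solvability constant; by
monotone convergence the Green integral of `|f|` lies in `L_p`, hence is finite at some point, and
then at all points. -/
theorem IsPrincipalSystemWith.greenBounded_of_correctlySolvable {r q u₁ v₁ : ℝ → ℝ}
    (hr : ∀ᵐ x : ℝ, 0 < r x) (h : IsPrincipalSystemWith r q u v u₁ v₁) {p : ℝ≥0∞}
    (hp : 1 ≤ p) (hp' : p ≠ ∞) (hS : CorrectlySolvable 𝕜 r q p) : GreenBounded 𝕜 u v p := by
  have hp0 : p ≠ 0 := (one_pos.trans_le hp).ne'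
  obtain ⟨hS, c, -, hc⟩ := hS
  obtain ⟨hu, -, hv, -⟩ := h.hasACDeriv hr
  -- The majorant of a truncation is the modulus of the `L_p`-solution with right-hand side the
  -- modulus of that truncation.
  have htrunc : ∀ f : ℝ → 𝕜, MemLp f p volume → ∀ n : ℕ,
      AEMeasurable (greenMajorant u v ((Icc (-n : ℝ) n).indicator f)) ∧
      eLpNorm (greenMajorant u v ((Icc (-n : ℝ) n).indicator f)) p volume ≤
        c * eLpNorm f p volume := by
    intro f hf n
    set g := (Icc (-n : ℝ) n).indicator f with hg
    have hgp : MemLp g p volume := hf.indicator measurableSet_Icc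
    have hgs : ∀ t, t ∉ Icc (-n : ℝ) n → g t = 0 := fun t ht => indicator_of_notMem ht f
    have hgt : TailsIntegrable u v g := .of_support hu.continuous hv.continuous
      (hgp.locallyIntegrable hp) hgs
    have hgn : MemLp (fun t => ((‖g t‖ : ℝ) : 𝕜)) p volume := hgp.norm.ofReal
    obtain ⟨y, ⟨hy, hyp⟩, -⟩ := hS _ hgn
    have hyG := h.eq_greenOp_of_support hr hp0 hp' (hgn.locallyIntegrable hp) (n := n)
      (fun t ht => by simp [hgs t ht]) hy hyp
    have hyH : ∀ x, ‖y x‖ₑ = greenMajorant u v g x := fun x => by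
      rw [hyG]
      exact enorm_greenOp_norm h.pos_u h.pos_v
        ((integrable_greenKernel_iff h.pos_u h.pos_v x).2 (hgt x))
    rw [← funext hyH]
    refine ⟨hy.continuous.enorm.measurable.aemeasurable, ?_⟩
    rw [eLpNorm_enorm]
    refine (hc _ _ hgn hy hyp).trans ?_
    gcongr
    refine eLpNorm_mono fun t => ?_
    rw [RCLike.norm_ofReal, abs_norm]
    exact norm_indicator_le_norm_self f t
  have hmaj : ∀ f : ℝ → 𝕜, MemLp f p volume →
      eLpNorm (greenMajorant u v f) p volume ≤ c * eLpNorm f p volume := by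
    intro f hf
    have := funext fun x => iSup_greenMajorant_indicator (u := u) (v := v) f x
    rw [← this]
    exact eLpNorm_iSup_le hp0 hp' (fun n => (htrunc f hf n).1)
      (monotone_greenMajorant_indicator f) fun n => (htrunc f hf n).2
  have htails : ∀ f : ℝ → 𝕜, MemLp f p volume → TailsIntegrable u v f := by
    intro f hf
    have hfin : eLpNorm (greenMajorant u v f) p volume < ∞ :=
      (hmaj f hf).trans_lt (ENNReal.mul_lt_top ENNReal.coe_lt_top hf.2)
    obtain ⟨x₀, hx₀⟩ : ∃ x, greenMajorant u v f x < ∞ := by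
      -- A function that is infinite everywhere has infinite norm, because `p < ∞`.
      by_contra! htop
      have h1 := lintegral_rpow_enorm_lt_top_of_eLpNorm_lt_top hp0 hp' hfin
      simp [fun x => top_le_iff.1 (htop x), ENNReal.toReal_pos hp0 hp'] at h1
    refine .of_integrable h.pos_u h.pos_v hu.continuous hv.continuous (hf.locallyIntegrable hp)
      (x₀ := x₀) ⟨?_, hx₀⟩
    refine AEStronglyMeasurable.smul (Measurable.aestronglyMeasurable ?_) hf.1
    exact Measurable.ite measurableSet_Iic (hv.continuous.measurable.const_mul _)
      (hu.continuous.measurable.mul_const _)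
  have hle : ∀ f : ℝ → 𝕜, MemLp f p volume →
      eLpNorm (greenOp u v f) p volume ≤ c * eLpNorm f p volume := fun f hf =>
    (eLpNorm_mono_enorm fun x => enorm_integral_le_lintegral_enorm _).trans (hmaj f hf)
  refine ⟨fun f hf => ⟨fun x => (integrable_greenKernel_iff h.pos_u h.pos_v x).2 (htails f hf x),
    ?_, (hle f hf).trans_lt (ENNReal.mul_lt_top ENNReal.coe_lt_top hf.2)⟩, c, hle⟩
  exact (h.isSolution_greenOp hr (hf.locallyIntegrable hp)
    (htails f hf)).continuous.aestronglyMeasurable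

end Green

end SturmLiouville

theorem theorem1p4 {𝕜 : Type*} [RCLike 𝕜] (r q : ℝ → ℝ)
    (hr : ∀ᵐ x : ℝ, 0 < r x) (hq : ∀ᵐ x : ℝ, 0 ≤ q x)
    (hr_loc : LocallyIntegrable (fun x => 1 / r x) volume)
    (hq_loc : LocallyIntegrable q volume)
    (hq_left : ∀ x : ℝ, 0 < ∫⁻ t in Iic x, ENNReal.ofReal (q t))
    (hq_right : ∀ x : ℝ, 0 < ∫⁻ t in Ici x, ENNReal.ofReal (q t))
    (p : ℝ≥0∞) (hp_one : 1 ≤ p) (hp_top : p ≠ ∞) :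
    (∃ u v : ℝ → ℝ, SturmLiouville.IsPrincipalSystem r q u v) ∧
      ∀ u v : ℝ → ℝ, SturmLiouville.IsPrincipalSystem r q u v →
        (SturmLiouville.CorrectlySolvable 𝕜 r q p ↔ SturmLiouville.GreenBounded 𝕜 u v p) := by
  refine ⟨SturmLiouville.exists_isPrincipalSystem hr hq hr_loc hq_loc (hq_left 0) (hq_right 0),
    fun u v ⟨u₁, v₁, h⟩ => ⟨h.greenBounded_of_correctlySolvable hr hp_one hp_top,
      h.correctlySolvable_of_greenBounded hr hp_one hp_top⟩⟩
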